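/- Let $M$ be a finite von Neumann algebra with a faithful normal trace $\tau$, $\tau(1)=1$, and let $B\subseteq M$ be a von Neumann subalgebra with the same unit. Let $M$ act by left multiplication on the Hilbert space $L^2(M,\tau)$, the completion of $M$ for the inner product $\langle x,y\rangle=\tau(x^*y)$ (conjugate linear in the first variable); write $\xi\in L^2(M,\tau)$ for the vector given by $1\in M$, let $e_B$ be the orthogonal projection of $L^2(M,\tau)$ onto the closure of $B\xi$, and let $\langle M,e_B\rangle$ be the von Neumann algebra on $L^2(M,\tau)$ generated by $M$ and $e_B$. Suppose that $B'\cap M\subseteq B$, and let $v\in M$ be an intertwiner of $B$, that is, a partial isometry with $vBv^*\subseteq B$ and $v^*v\in B$. Then $v^*e_Bv$ is a projection, it belongs to $(B'\cap\langle M,e_B\rangle)v^*v=\{xv^*v : x\in B'\cap\langle M,e_B\rangle\}$, and it commutes with every element of $(B'\cap\langle M,e_B\rangle)v^*v$; in other words, $v^*e_Bv$ is a central projection of $(B'\cap\langle M,e_B\rangle)v^*v$. -/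

import Mathlib

open scoped ComplexOrder InnerProductSpace

noncomputable section

namespace BasicConstruction

universe u

variable {K : Type u} [NormedAddCommGroup K] [InnerProductSpace ℂ K] [CompleteSpace K]

/-- The von Neumann algebra on `K` generated by a set `s` of bounded operators: the double
commutant of `s ∪ s*`. -/
def generated (s : Set (K →L[ℂ] K)) : VonNeumannAlgebra K where
  toStarSubalgebra := StarSubalgebra.centralizer ℂ (StarSubalgebra.centralizer ℂ s : Set (K →L[ℂ] K))
  centralizer_centralizer' := by
    change Set.centralizer (Set.centralizer
      ((StarSubalgebra.centralizer ℂ (StarSubalgebra.centralizer ℂ s : Set (K →L[ℂ] K)) :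
        StarSubalgebra ℂ (K →L[ℂ] K)) : Set (K →L[ℂ] K))) =
      ((StarSubalgebra.centralizer ℂ (StarSubalgebra.centralizer ℂ s : Set (K →L[ℂ] K)) :
        StarSubalgebra ℂ (K →L[ℂ] K)) : Set (K →L[ℂ] K))
    rw [StarSubalgebra.coe_centralizer]
    exact Set.centralizer_centralizer_centralizer _

/-- The elements of a von Neumann algebra, as a type. -/
abbrev Elem (M : VonNeumannAlgebra K) : Type u := M.toStarSubalgebra

instance isClosed_coe (M : VonNeumannAlgebra K) :
    IsClosed (M.toStarSubalgebra : Set (K →L[ℂ] K)) := by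
  rw [VonNeumannAlgebra.coe_toStarSubalgebra, ← M.centralizer_centralizer]
  exact Set.isClosed_centralizer _

/-- The order on a von Neumann algebra, for which the nonnegative elements are the `x* x`. -/
instance instPartialOrder (M : VonNeumannAlgebra K) : PartialOrder (Elem M) :=
  CStarAlgebra.spectralOrder (Elem M)

instance instStarOrderedRing (M : VonNeumannAlgebra K) : StarOrderedRing (Elem M) :=
  CStarAlgebra.spectralOrderedRing (Elem M)

/-- A faithful normal trace `τ` on `M` with `τ 1 = 1`. Normality is ultraweak continuity:
`τ` is of the form `x ↦ ∑ i, ⟪ζ i, x (η i)⟫` with square-summable sequences of vectors. -/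
structure FaithfulNormalTrace (M : VonNeumannAlgebra K) where
  toLinearMap : Elem M →ₗ[ℂ] ℂ
  map_one : toLinearMap 1 = 1
  nonneg : ∀ x, 0 ≤ toLinearMap (star x * x)
  tracial : ∀ x y, toLinearMap (x * y) = toLinearMap (y * x)
  faithful : ∀ x, toLinearMap (star x * x) = 0 → x = 0
  normal : ∃ ζ η : ℕ → K, Summable (fun i => ‖ζ i‖ ^ 2) ∧ Summable (fun i => ‖η i‖ ^ 2) ∧
    ∀ x : Elem M, HasSum (fun i => ⟪ζ i, (x : K →L[ℂ] K) (η i)⟫_ℂ) (toLinearMap x)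

variable {M : VonNeumannAlgebra K}

/-- The trace as a positive linear functional. -/
def FaithfulNormalTrace.toPositive (τ : FaithfulNormalTrace M) : Elem M →ₚ[ℂ] ℂ :=
  PositiveLinearMap.mk₀ τ.toLinearMap fun x hx => by
    obtain ⟨y, rfl⟩ := CStarAlgebra.nonneg_iff_eq_star_mul_self.mp hx
    exact τ.nonneg y

/-- `L²(M, τ)`: the completion of `M` for the inner product `⟪x, y⟫ = τ (x* y)`. -/
abbrev L2 (τ : FaithfulNormalTrace M) : Type u := τ.toPositive.GNS

/-- The vector `x ξ` of `L²(M, τ)` given by `x ∈ M`. -/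
def toL2 (τ : FaithfulNormalTrace M) : Elem M →ₗ[ℂ] L2 τ :=
  (UniformSpace.Completion.toComplL (𝕜 := ℂ) (E := τ.toPositive.PreGNS)).toLinearMap ∘ₗ
    τ.toPositive.toPreGNS.toLinearMap

/-- The standard representation of `M` on `L²(M, τ)` by left multiplication. -/
def lmul (τ : FaithfulNormalTrace M) : Elem M →⋆ₐ[ℂ] (L2 τ →L[ℂ] L2 τ) :=
  τ.toPositive.gnsStarAlgHom

/-- `L²(B)`: the closure in `L²(M, τ)` of the vectors `b ξ`, `b ∈ B` (for `B ⊆ M`). -/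
def L2Sub (τ : FaithfulNormalTrace M) (B : VonNeumannAlgebra K) : Submodule ℂ (L2 τ) :=
  (Submodule.span ℂ {η : L2 τ | ∃ b : Elem M, (b : K →L[ℂ] K) ∈ B ∧ η = toL2 τ b}).topologicalClosure

instance instCompleteL2Sub (τ : FaithfulNormalTrace M) (B : VonNeumannAlgebra K) :
    CompleteSpace (L2Sub τ B) :=
  (Submodule.isClosed_topologicalClosure _).completeSpace_coe

/-- The Jones projection `e_B`: the orthogonal projection of `L²(M, τ)` onto `L²(B)`. -/
def jones (τ : FaithfulNormalTrace M) (B : VonNeumannAlgebra K) : L2 τ →L[ℂ] L2 τ :=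
  (L2Sub τ B).starProjection

/-- The basic construction `⟨M, e_B⟩`: the von Neumann algebra on `L²(M, τ)` generated by `M`
and `e_B`. -/
def basic (τ : FaithfulNormalTrace M) (B : VonNeumannAlgebra K) : VonNeumannAlgebra (L2 τ) :=
  generated (Set.range (lmul τ) ∪ {jones τ B})

/-- `B' ∩ ⟨M, e_B⟩`. -/
def relComm (τ : FaithfulNormalTrace M) (B : VonNeumannAlgebra K) : Set (L2 τ →L[ℂ] L2 τ) :=
  Set.centralizer (lmul τ '' {b : Elem M | (b : K →L[ℂ] K) ∈ B}) ∩ basic τ B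

/-- The cutdown `(B' ∩ ⟨M, e_B⟩) p` by `p ∈ M`. -/
def cutdown (τ : FaithfulNormalTrace M) (B : VonNeumannAlgebra K) (p : Elem M) :
    Set (L2 τ →L[ℂ] L2 τ) :=
  {y | ∃ x ∈ relComm τ B, y = x * lmul τ p}

/-- The operator `v* e_B v` on `L²(M, τ)`, for `v ∈ M`. -/
def conjJones (τ : FaithfulNormalTrace M) (B : VonNeumannAlgebra K) (v : Elem M) :
    L2 τ →L[ℂ] L2 τ :=
  lmul τ (star v) * jones τ B * lmul τ v

/-- The intertwiners of `B` in `M`: the partial isometries `v ∈ M` with `v B v* ⊆ B` and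
`v* v ∈ B`. -/
structure IsIntertwiner (B : VonNeumannAlgebra K) (v : Elem M) : Prop where
  partialIsometry : v * star v * v = v
  conj_mem : ∀ b ∈ B, (v : K →L[ℂ] K) * b * star (v : K →L[ℂ] K) ∈ B
  source_mem : star (v : K →L[ℂ] K) * (v : K →L[ℂ] K) ∈ B

end BasicConstruction

end

/-! Write `e` for the Jones projection, `p = v* v` and `f = v* e v`. Since `v B v* ⊆ B` commutes
with `e`, `f` is a projection under `p` commuting with `p B p`. Such an `f` has the form `x p` with
`x ∈ B'`: the symmetry `y = 2f - 1` extends from the corner by `T (∑ b p k) = ∑ b p y k`, and `x =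
(T + 1)/2`. The extension is canonical, so it commutes with whatever commutes with `B` and `f`, in
particular with the commutant of `⟨M, e⟩`; hence `x ∈ ⟨M, e⟩` (`exists_centralizer_mul_eq`).

For centrality it suffices that `f x f = x f` for all `x ∈ B' ∩ ⟨M, e⟩`, by taking adjoints. As `x`
and `f` commute with right multiplication by `B`, this reduces to `f η = η` for `η = x (v* ξ)`. The
vector `ω = η v` satisfies `p ω = ω` and `b ω = ω b` for `b` in `N = B ∩ {p}'`. If `ω ∈ L²(B)`, then
`v η = v ω v* ∈ L²(B)`, whence `f η = v* v η = η`.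

That `ω ∈ L²(B)` is where `B' ∩ M ⊆ B` enters (`mem_L2Sub_of_commute_corner`). Subtract from `ω` its
projection to `L²(B)`. Against the difference, `x ξ` with `x ∈ M` may be replaced by `y ξ` with `y ∈
N' ∩ M`, by averaging over unitaries of `N` (`exists_average`), and then by `p y ξ`. The same corner
extension, applied to unitaries of `N' ∩ M`, gives `p y = y p ∈ B`, so the pairing vanishes. -/

open scoped ComplexOrder InnerProductSpace

noncomputable section

namespace BasicConstruction

/-! ### Hilbert space operators: invariant subspaces, extension from a corner, weak limits. -/

section Hilbert

variable {H : Type*} [NormedAddCommGroup H] [InnerProductSpace ℂ H] [CompleteSpace H]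

/-- A bounded operator leaving a subspace invariant together with its adjoint commutes with the
orthogonal projection onto that subspace. -/
theorem commute_starProjection {U : Submodule ℂ H} [U.HasOrthogonalProjection] {T : H →L[ℂ] H}
    (h : ∀ x ∈ U, T x ∈ U) (h' : ∀ x ∈ U, star T x ∈ U) : Commute U.starProjection T := by
  have key : ∀ S : H →L[ℂ] H, (∀ x ∈ U, S x ∈ U) →
      U.starProjection * S * U.starProjection = S * U.starProjection := by
    intro S hS
    ext x
    exact Submodule.starProjection_eq_self_iff.mpr (hS _ (U.starProjection_apply_mem x))
  have h1 := key T h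
  have h2 := congrArg star (key (star T) h')
  simp only [star_mul, star_star, (isSelfAdjoint_starProjection U).star_eq] at h2
  rw [← mul_assoc] at h2
  exact h2.symm.trans h1

/-- Two bounded operators agreeing on the range of a linear map and on its orthogonal complement
are equal. -/
theorem ext_of_range_of_orthogonal {L : Type*} [AddCommGroup L] [Module ℂ L] {Φ : L →ₗ[ℂ] H}
    {S T : H →L[ℂ] H} (h : ∀ f, S (Φ f) = T (Φ f))
    (h' : ∀ w ∈ (LinearMap.range Φ)ᗮ, S w = T w) : S = T := by
  have hcl : ∀ x ∈ (LinearMap.range Φ).topologicalClosure, S x = T x := by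
    intro x hx
    have hsub : closure (LinearMap.range Φ : Set H) ⊆ {x | S x = T x} :=
      closure_minimal (by rintro _ ⟨f, rfl⟩; exact h f)
        (isClosed_eq S.continuous T.continuous)
    exact hsub hx
  have : CompleteSpace (LinearMap.range Φ).topologicalClosure :=
    (Submodule.isClosed_topologicalClosure _).completeSpace_coe
  ext x
  have h1 := hcl _ ((LinearMap.range Φ).topologicalClosure.starProjection_apply_mem x)
  have h2 := h' (x - (LinearMap.range Φ).topologicalClosure.starProjection x) (by
    rw [← Submodule.orthogonal_closure]
    exact Submodule.sub_starProjection_mem_orthogonal x)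
  rw [map_sub, map_sub, h1] at h2
  exact sub_left_injective h2

/-- A contractive relation between two linear maps is implemented by a bounded operator that
vanishes on the orthogonal complement of the range of the first. -/
theorem exists_map_eq_of_norm_le {L : Type*} [AddCommGroup L] [Module ℂ L] (Φ Ψ : L →ₗ[ℂ] H)
    (h : ∀ f, ‖Ψ f‖ ≤ ‖Φ f‖) :
    ∃ T : H →L[ℂ] H, (∀ f, T (Φ f) = Ψ f) ∧ ∀ w ∈ (LinearMap.range Φ)ᗮ, T w = 0 := by
  set U := (LinearMap.range Φ).topologicalClosure with hU
  have : CompleteSpace U := (Submodule.isClosed_topologicalClosure _).completeSpace_coe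
  have hmem : ∀ f, Φ f ∈ U := fun f =>
    (LinearMap.range Φ).le_topologicalClosure (LinearMap.mem_range_self Φ f)
  let e : L →ₗ[ℂ] U := Φ.codRestrict U hmem
  have hd : DenseRange e := by
    intro x
    rw [closure_subtype]
    have : ((↑) '' Set.range e : Set H) = LinearMap.range Φ := by
      ext y; constructor
      · rintro ⟨_, ⟨f, rfl⟩, rfl⟩; exact ⟨f, rfl⟩
      · rintro ⟨f, rfl⟩; exact ⟨e f, ⟨f, rfl⟩, rfl⟩
    rw [this]
    exact x.2
  refine ⟨(Ψ.extendOfNorm e) ∘L U.orthogonalProjectionOnto, fun f => ?_, fun w hw => ?_⟩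
  · have : U.orthogonalProjectionOnto (Φ f) = e f := by
      exact U.orthogonalProjectionOnto_mem_subspace_eq_self (e f)
    rw [ContinuousLinearMap.comp_apply, this]
    exact LinearMap.extendOfNorm_eq hd ⟨1, fun f => by simpa [e] using h f⟩ f
  · rw [← Submodule.orthogonal_closure] at hw
    have : U.orthogonalProjectionOnto w = 0 :=
      Submodule.orthogonalProjectionOnto_apply_of_mem_orthogonal hw
    rw [ContinuousLinearMap.comp_apply, this, map_zero]

/-- An isometry commuting with the corner `p A p` of a `*`-algebra `A` of operators coincides
under `p` with an element of the commutant of `A`. -/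
theorem exists_centralizer_extension (A : StarSubalgebra ℂ (H →L[ℂ] H)) {p y : H →L[ℂ] H}
    (hpA : p ∈ A) (hp : IsStarProjection p) (hy : star y * y = 1) (hyp : Commute y p)
    (hyA : ∀ b ∈ A, Commute y (p * b * p)) :
    ∃ T ∈ Set.centralizer (A : Set (H →L[ℂ] H)), T * p = y * p ∧
      ∀ m ∈ Set.centralizer (A : Set (H →L[ℂ] H)), Commute m y → Commute T m := by
  -- Finitely supported functions encode formal sums `∑ b k`. The operator `T` has to carry `Φ f` to
  -- `Ψ f`; equality of the two Gram forms makes it well defined and isometric on the range of `Φ`.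
  let Φ : (A →₀ H) →ₗ[ℂ] H := Finsupp.lsum ℂ fun b : A => ((b : H →L[ℂ] H) * p).toLinearMap
  let Ψ : (A →₀ H) →ₗ[ℂ] H := Finsupp.lsum ℂ fun b : A => ((b : H →L[ℂ] H) * p * y).toLinearMap
  have hΦs : ∀ b k, Φ (Finsupp.single b k) = (b : H →L[ℂ] H) (p k) := by intro b k; simp [Φ]
  have hΨs : ∀ b k, Ψ (Finsupp.single b k) = (b : H →L[ℂ] H) (p (y k)) := by intro b k; simp [Ψ]
  have hinner : ∀ f g, ⟪Ψ f, Ψ g⟫_ℂ = ⟪Φ f, Φ g⟫_ℂ := by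
    intro f g
    induction f using Finsupp.induction_linear with
    | zero => simp
    | add f₁ f₂ h₁ h₂ => simp only [map_add, inner_add_left, h₁, h₂]
    | single b k =>
      induction g using Finsupp.induction_linear with
      | zero => simp
      | add f₁ f₂ h₁ h₂ => simp only [map_add, inner_add_right, h₁, h₂]
      | single c l =>
        rw [hΦs, hΦs, hΨs, hΨs]
        -- The middle factor `p b* c p` lies in the corner, so `y` moves past it and meets `y*`.
        have hop : star ((b : H →L[ℂ] H) * p * y) * ((c : H →L[ℂ] H) * p * y) =
            star ((b : H →L[ℂ] H) * p) * ((c : H →L[ℂ] H) * p) := by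
          have hc := (hyA _ (mul_mem (star_mem b.2) c.2)).eq
          simp only [star_mul, hp.isSelfAdjoint.star_eq]
          calc star y * (p * star (b : H →L[ℂ] H)) * ((c : H →L[ℂ] H) * p * y)
              = star y * (p * (star (b : H →L[ℂ] H) * c) * p * y) := by simp only [mul_assoc]
            _ = star y * y * (p * (star (b : H →L[ℂ] H) * c) * p) := by
              rw [← hc]; simp only [mul_assoc]
            _ = _ := by rw [hy, one_mul]; simp only [mul_assoc]
        have h1 : ∀ S R : H →L[ℂ] H, ⟪S k, R l⟫_ℂ = ⟪k, (star S * R) l⟫_ℂ := by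
          intro S R
          simp [ContinuousLinearMap.star_eq_adjoint, ContinuousLinearMap.adjoint_inner_right]
        have h2 := h1 ((b : H →L[ℂ] H) * p * y) ((c : H →L[ℂ] H) * p * y)
        have h3 := h1 ((b : H →L[ℂ] H) * p) ((c : H →L[ℂ] H) * p)
        rw [hop, ← h3] at h2
        exact h2
  obtain ⟨T, hT, hT0⟩ := exists_map_eq_of_norm_le Φ Ψ fun f => by
    rw [@norm_eq_sqrt_re_inner ℂ, @norm_eq_sqrt_re_inner ℂ, hinner]
  have horth : ∀ S : H →L[ℂ] H, (∀ f, star S (Φ f) ∈ LinearMap.range Φ) →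
      ∀ w ∈ (LinearMap.range Φ)ᗮ, S w ∈ (LinearMap.range Φ)ᗮ := by
    rintro S hS w hw _ ⟨f, rfl⟩
    rw [← ContinuousLinearMap.adjoint_inner_left, ← ContinuousLinearMap.star_eq_adjoint]
    exact hw _ (hS f)
  have hleft : ∀ b ∈ A, ∀ f, b (Φ f) ∈ LinearMap.range Φ := by
    intro b hb f
    induction f using Finsupp.induction_linear with
    | zero => simp
    | add f₁ f₂ h₁ h₂ => simp only [map_add]; exact add_mem h₁ h₂
    | single c l => exact ⟨Finsupp.single (⟨b, hb⟩ * c) l, by rw [hΦs, hΦs]; rfl⟩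
  have hcomm : ∀ m ∈ Set.centralizer (A : Set (H →L[ℂ] H)), ∀ b : A, ∀ l,
      m ((b : H →L[ℂ] H) l) = (b : H →L[ℂ] H) (m l) := by
    intro m hm b l
    exact (DFunLike.congr_fun (hm _ b.2) l).symm
  have hright : ∀ m ∈ Set.centralizer (A : Set (H →L[ℂ] H)), ∀ f,
      m (Φ f) ∈ LinearMap.range Φ := by
    intro m hm f
    induction f using Finsupp.induction_linear with
    | zero => simp
    | add f₁ f₂ h₁ h₂ => simp only [map_add]; exact add_mem h₁ h₂
    | single c l =>
      exact ⟨Finsupp.single c (m l), by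
        rw [hΦs, hΦs, hcomm m hm, ← hcomm m hm ⟨p, hpA⟩ l]⟩
  -- Commutation is checked on the range of `Φ` and on its orthogonal complement, where `T`
  -- vanishes. `A` and its commutant preserve both because each is closed under adjoints.
  refine ⟨T, fun b hb => ?_, ?_, fun m hm hmy => ?_⟩
  · refine ext_of_range_of_orthogonal (Φ := Φ) (fun f => ?_) fun w hw => ?_
    · rw [mul_apply_eq_comp, mul_apply_eq_comp]
      induction f using Finsupp.induction_linear with
      | zero => simp
      | add f₁ f₂ h₁ h₂ => simp only [map_add, h₁, h₂]
      | single c l =>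
        have : b (Φ (Finsupp.single c l)) = Φ (Finsupp.single (⟨b, hb⟩ * c) l) := by
          rw [hΦs, hΦs]; rfl
        rw [this, hT, hT, hΨs, hΨs]; rfl
    · have := hT0 _ (horth b (hleft _ (star_mem hb)) w hw)
      rw [mul_apply_eq_comp, mul_apply_eq_comp, hT0 w hw, map_zero, this]
  · ext k
    have h1 := hT (Finsupp.single 1 k)
    rw [hΦs, hΨs] at h1
    have h2 := DFunLike.congr_fun hyp.eq k
    simp only [mul_apply_eq_comp] at h2 ⊢
    rw [h2]
    exact h1
  · have hm' : star m ∈ Set.centralizer (A : Set (H →L[ℂ] H)) := by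
      intro b hb
      have := congrArg star (hm (star b) (star_mem hb))
      simpa using this.symm
    refine ext_of_range_of_orthogonal (Φ := Φ) (fun f => ?_) fun w hw => ?_
    · rw [mul_apply_eq_comp, mul_apply_eq_comp]
      induction f using Finsupp.induction_linear with
      | zero => simp
      | add f₁ f₂ h₁ h₂ => simp only [map_add, h₁, h₂]
      | single c l =>
        have : m (Φ (Finsupp.single c l)) = Φ (Finsupp.single c (m l)) := by
          rw [hΦs, hΦs, hcomm m hm, ← hcomm m hm ⟨p, hpA⟩ l]
        have h2 := DFunLike.congr_fun hmy.eq l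
        simp only [mul_apply_eq_comp] at h2
        rw [this, hT, hT, hΨs, hΨs, hcomm m hm, hcomm m hm ⟨p, hpA⟩, h2]
    · have := hT0 _ (horth m (hright _ hm') w hw)
      rw [mul_apply_eq_comp, mul_apply_eq_comp, hT0 w hw, map_zero, this]

open Filter Topology in
/-- A bounded family of operators converges weakly along every ultrafilter. -/
theorem exists_weak_limit {ι : Type*} (F : Ultrafilter ι) {g : ι → H →L[ℂ] H} {r : ℝ}
    (hg : ∀ i, ‖g i‖ ≤ r) :
    ∃ T : H →L[ℂ] H, ‖T‖ ≤ r ∧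
      ∀ v w, Tendsto (fun i => ⟪g i v, w⟫_ℂ) F (𝓝 ⟪T v, w⟫_ℂ) := by
  have hbound : ∀ i v w, ‖⟪g i v, w⟫_ℂ‖ ≤ r * ‖v‖ * ‖w‖ := fun i v w =>
    (norm_inner_le_norm _ _).trans (by gcongr; exact (g i).le_of_opNorm_le (hg i) v)
  have hr : 0 ≤ r := (norm_nonneg _).trans (hg (F.nonempty_of_mem univ_mem).some)
  have hex : ∀ v w, ∃ z, Tendsto (fun i => ⟪g i v, w⟫_ℂ) F (𝓝 z) := by
    intro v w
    -- The matrix coefficients stay in a compact disc, so the ultrafilter has a limit there.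
    obtain ⟨z, -, hz⟩ := (isCompact_closedBall (0 : ℂ) (r * ‖v‖ * ‖w‖)).ultrafilter_le_nhds
      (F.map fun i => ⟪g i v, w⟫_ℂ) (by
        simp only [Ultrafilter.coe_map, le_principal_iff, mem_map]
        exact univ_mem' fun i => by simpa using hbound i v w)
    exact ⟨z, hz⟩
  choose β hβ using hex
  let B : H →ₗ⋆[ℂ] H →ₗ[ℂ] ℂ := LinearMap.mk₂'ₛₗ (starRingEnd ℂ) (RingHom.id ℂ) β
    (fun v v' w => tendsto_nhds_unique (hβ _ _) (by
      simpa only [map_add, inner_add_left] using (hβ v w).add (hβ v' w)))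
    (fun c v w => tendsto_nhds_unique (hβ _ _) (by
      simpa only [map_smul, inner_smul_left, smul_eq_mul] using (hβ v w).const_mul (starRingEnd ℂ c)))
    (fun v w w' => tendsto_nhds_unique (hβ _ _) (by
      simpa only [inner_add_right] using (hβ v w).add (hβ v w')))
    (fun c v w => tendsto_nhds_unique (hβ _ _) (by
      simpa only [inner_smul_right, smul_eq_mul, RingHom.id_apply] using (hβ v w).const_mul c))
  have hB : ∀ v w, ‖B v w‖ ≤ r * ‖v‖ * ‖w‖ := fun v w =>
    le_of_tendsto (hβ v w).norm (Eventually.of_forall fun i => hbound i v w)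
  let T := InnerProductSpace.continuousLinearMapOfBilin (𝕜 := ℂ) (B.mkContinuous₂ r hB)
  have hT : ∀ v w, ⟪T v, w⟫_ℂ = β v w := fun v w =>
    InnerProductSpace.continuousLinearMapOfBilin_apply _ v w
  refine ⟨T, T.opNorm_le_bound hr fun v => ?_, fun v w => by rw [hT]; exact hβ v w⟩
  -- Testing against `w = T v` gives `‖T v‖² ≤ r ‖v‖ ‖T v‖`.
  have h1 := hB v (T v)
  change ‖β v (T v)‖ ≤ _ at h1
  rw [← hT, inner_self_eq_norm_sq_to_K, norm_pow, RCLike.norm_ofReal, abs_norm] at h1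
  rcases (norm_nonneg (T v)).eq_or_lt with h0 | h0
  · rw [← h0]; positivity
  · rw [pow_two] at h1
    exact le_of_mul_le_mul_right h1 h0

end Hilbert

/-! ### Unitaries, fixed points by convexity, and projections in a corner. -/

/-- A closed unital `*`-algebra of operators is spanned by its unitaries. -/
theorem mem_of_unitary_mem {H : Type*} [NormedAddCommGroup H] [InnerProductSpace ℂ H]
    [CompleteSpace H] (S : StarSubalgebra ℂ (H →L[ℂ] H)) (hS : IsClosed (S : Set (H →L[ℂ] H)))
    (V : Submodule ℂ (H →L[ℂ] H)) (h : ∀ u ∈ S, star u * u = 1 → u * star u = 1 → u ∈ V) :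
    ∀ x ∈ S, x ∈ V := by
  intro x hx
  have : (⟨x, hx⟩ : S) ∈ Submodule.span ℂ (unitary S : Set S) := by
    rw [CStarAlgebra.span_unitary]; trivial
  have h2 : Submodule.span ℂ (unitary S : Set S) ≤ V.comap S.subtype.toAlgHom.toLinearMap := by
    refine Submodule.span_le.mpr fun u hu => ?_
    exact h _ u.2 (congrArg Subtype.val hu.1) (congrArg Subtype.val hu.2)
  exact h2 this

/-- A nonempty closed convex set has a unique element of minimal norm. -/
theorem exists_unique_minimal_norm {H : Type*} [NormedAddCommGroup H] [InnerProductSpace ℂ H]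
    [CompleteSpace H] {C : Set H} (hne : C.Nonempty) (hcl : IsClosed C) (hconv : Convex ℝ C) :
    ∃ c ∈ C, ∀ c' ∈ C, ‖c'‖ ≤ ‖c‖ → c' = c := by
  let : InnerProductSpace ℝ H := InnerProductSpace.rclikeToReal ℂ H
  obtain ⟨c, hc, hmin⟩ := exists_norm_eq_iInf_of_complete_convex hne hcl.isComplete hconv 0
  have hle : ∀ w ∈ C, ‖c‖ ≤ ‖w‖ := by
    intro w hw
    have h1 := ciInf_le (f := fun w : C => ‖(0 : H) - w‖)
      ⟨0, Set.forall_mem_range.2 fun _ => norm_nonneg _⟩ ⟨w, hw⟩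
    rw [← hmin] at h1
    simpa using h1
  refine ⟨c, hc, fun c' hc' h => ?_⟩
  have hmid := hle _ (hconv hc hc' (a := 1 / 2) (b := 1 / 2) (by norm_num) (by norm_num)
    (by norm_num))
  rw [← smul_add, norm_smul] at hmid
  have hpar := parallelogram_law_with_norm ℂ c c'
  have h2 : ‖c + c'‖ ≥ 2 * ‖c‖ := by
    norm_num at hmid
    linarith
  have h0 : ‖c - c'‖ = 0 := by
    nlinarith [norm_nonneg (c - c'), norm_nonneg c, norm_nonneg c', norm_nonneg (c + c')]
  exact (sub_eq_zero.mp (norm_eq_zero.mp h0)).symm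

/-- Fixed points of a semigroup of contractions by convexity: any closed convex set containing the
orbit of `x` contains a fixed point that is indistinguishable from `x` by functionals constant on
the orbit. -/
theorem exists_fixed_mem_of_contractions {H : Type*} [NormedAddCommGroup H]
    [InnerProductSpace ℂ H] [CompleteSpace H] {G : Set (H →L[ℂ] H)} (hone : 1 ∈ G)
    (hmul : ∀ g ∈ G, ∀ h ∈ G, g * h ∈ G) (hnorm : ∀ g ∈ G, ∀ z, ‖g z‖ ≤ ‖z‖) (x : H)
    {D : Set H} (hD : IsClosed D) (hDconv : Convex ℝ D) (hxD : ∀ g ∈ G, g x ∈ D) :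
    ∃ c ∈ D, (∀ g ∈ G, g c = c) ∧
      ∀ ω : H, (∀ g ∈ G, ⟪ω, g x⟫_ℂ = ⟪ω, x⟫_ℂ) → ⟪ω, c⟫_ℂ = ⟪ω, x⟫_ℂ := by
  let C₀ : Set H := (fun g : H →L[ℂ] H => g x) '' G
  obtain ⟨c, hc, hmin⟩ := exists_unique_minimal_norm (C := closedConvexHull ℝ C₀)
    ⟨_, subset_closedConvexHull ⟨1, hone, rfl⟩⟩ isClosed_closedConvexHull convex_closedConvexHull
  refine ⟨c, closedConvexHull_min ?_ hDconv hD hc, fun g hg => ?_, fun ω hω => ?_⟩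
  · rintro _ ⟨g, hg, rfl⟩
    exact hxD g hg
  -- `g c` stays in the hull and is no longer than `c`, so uniqueness of the shortest element forces
  -- `g c = c`.
  · refine hmin _ ?_ (hnorm g hg c)
    have hsub : closedConvexHull ℝ C₀ ⊆ g ⁻¹' closedConvexHull ℝ C₀ := by
      refine closedConvexHull_min ?_
        (convex_closedConvexHull.linear_preimage (g.toLinearMap.restrictScalars ℝ))
        (isClosed_closedConvexHull.preimage g.continuous)
      rintro _ ⟨h, hh, rfl⟩
      exact subset_closedConvexHull ⟨g * h, hmul g hg h hh, rfl⟩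
    exact hsub hc
  · have hsub : closedConvexHull ℝ C₀ ⊆ {z | ⟪ω, z⟫_ℂ = ⟪ω, x⟫_ℂ} := by
      refine closedConvexHull_min ?_ ?_
        (isClosed_eq (continuous_const.inner continuous_id) continuous_const)
      · rintro _ ⟨g, hg, rfl⟩
        exact hω g hg
      · exact (convex_singleton (𝕜 := ℝ) ⟪ω, x⟫_ℂ).linear_preimage
          ((innerSL ℂ ω).toLinearMap.restrictScalars ℝ)
    exact hsub hc

/-- A projection `f ≤ p` commuting with the corner `p A p` is of the form `x p` with `x` in the
commutant of `A`. -/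
theorem exists_centralizer_mul_eq {H : Type*} [NormedAddCommGroup H] [InnerProductSpace ℂ H]
    [CompleteSpace H] (A : StarSubalgebra ℂ (H →L[ℂ] H)) {p f : H →L[ℂ] H} (hpA : p ∈ A)
    (hp : IsStarProjection p) (hf : IsStarProjection f) (hpf : p * f = f) (hfp : f * p = f)
    (hfA : ∀ b ∈ A, Commute f (p * b * p)) :
    ∃ x ∈ Set.centralizer (A : Set (H →L[ℂ] H)), f = x * p ∧
      ∀ m ∈ Set.centralizer (A : Set (H →L[ℂ] H)), Commute m f → Commute m x := by
  have hff : f * f = f := hf.isIdempotentElem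
  -- The extension lemma needs an isometry, so it is applied to the symmetry `2 f - 1`.
  have hy : star (2 * f - 1) * (2 * f - 1) = 1 := by
    have : star (2 * f - 1) = 2 * f - 1 := by
      rw [star_sub, star_mul, hf.isSelfAdjoint.star_eq, star_one, star_ofNat, mul_two, two_mul]
    rw [this]
    have h4 : (2 * f - 1) * (2 * f - 1) = 4 * (f * f) - 4 * f + 1 := by noncomm_ring
    rw [h4, hff, sub_self, zero_add]
  have hycomm : ∀ m, Commute m f → Commute (2 * f - 1) m := fun m hm =>
    (((Commute.ofNat_right m 2).mul_right hm).sub_right (Commute.one_right m)).symm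
  obtain ⟨T, hTA, hTp, hT⟩ := exists_centralizer_extension A hpA hp hy
    (hycomm p (hpf.trans hfp.symm)) fun b hb => hycomm _ (hfA b hb).symm
  refine ⟨(1 / 2 : ℂ) • (T + 1), fun b hb => ?_, ?_, fun m hm hmf => ?_⟩
  · have h1 : b * T = T * b := hTA b hb
    rw [mul_smul_comm, smul_mul_assoc, mul_add, add_mul, h1, mul_one, one_mul]
  · rw [smul_mul_assoc, add_mul, hTp, one_mul, sub_mul, one_mul, sub_add_cancel, mul_assoc,
      hfp, two_mul, ← two_smul ℂ f, smul_smul]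
    norm_num
  · exact (((hT m hm (hycomm m hmf).symm).symm).add_right (Commute.one_right m)).smul_right _

/-- If `v w v = v`, `w v w = w` and `e` commutes with `v b w`, then `w e v` commutes with the
compression of `b` by `w v`. -/
theorem commute_conj_of_commute {R : Type*} [Ring R] {v w e b : R} (h : v * w * v = v)
    (h' : w * v * w = w) (he : Commute e (v * b * w)) :
    Commute (w * e * v) (w * v * b * (w * v)) := by
  have he := he.eq
  change w * e * v * (w * v * b * (w * v)) = w * v * b * (w * v) * (w * e * v)
  calc w * e * v * (w * v * b * (w * v)) = w * e * (v * w * v) * b * w * v := by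
        simp only [mul_assoc]
    _ = w * (e * (v * b * w)) * v := by rw [h]; simp only [mul_assoc]
    _ = w * v * b * (w * v * w) * e * v := by rw [he, h']; simp only [mul_assoc]
    _ = _ := by simp only [mul_assoc]

/-! ### Left and right multiplication on `L²(M, τ)`, the Jones projection and the basic
construction. -/

section L2

universe u

variable {K : Type u} [NormedAddCommGroup K] [InnerProductSpace ℂ K] [CompleteSpace K]
variable {M : VonNeumannAlgebra K} (τ : FaithfulNormalTrace M)

theorem inner_toL2 (x y : Elem M) : ⟪toL2 τ x, toL2 τ y⟫_ℂ = τ.toLinearMap (star x * y) :=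
  UniformSpace.Completion.inner_coe (𝕜 := ℂ) (E := τ.toPositive.PreGNS) _ _

theorem denseRange_toL2 : DenseRange (toL2 τ) :=
  UniformSpace.Completion.denseRange_coe (α := τ.toPositive.PreGNS)

theorem lmul_toL2 (x y : Elem M) : lmul τ x (toL2 τ y) = toL2 τ (x * y) :=
  τ.toPositive.gnsNonUnitalStarAlgHom_apply_coe

theorem toL2_injective : Function.Injective (toL2 τ) := by
  refine (injective_iff_map_eq_zero _).mpr fun x hx => τ.faithful x ?_
  rw [← inner_toL2, hx, inner_zero_left]

/-- Traciality makes the adjoint isometric in the 2-norm; right multiplication is therefore bounded,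
being left multiplication conjugated by it. -/
theorem norm_toL2_star (x : Elem M) : ‖toL2 τ (star x)‖ = ‖toL2 τ x‖ := by
  rw [@norm_eq_sqrt_re_inner ℂ, @norm_eq_sqrt_re_inner ℂ, inner_toL2, inner_toL2, star_star,
    τ.tracial]

theorem norm_toL2_mul_le (x y : Elem M) : ‖toL2 τ (x * y)‖ ≤ ‖lmul τ (star y)‖ * ‖toL2 τ x‖ := by
  rw [← norm_toL2_star τ (x * y), star_mul, ← lmul_toL2, ← norm_toL2_star τ x]
  exact (lmul τ (star y)).le_opNorm _

/-- Right multiplication by `y ∈ M` on `L²(M, τ)`. -/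
def rmul (y : Elem M) : L2 τ →L[ℂ] L2 τ :=
  (toL2 τ ∘ₗ LinearMap.mulRight ℂ y).extendOfNorm (toL2 τ)

theorem rmul_toL2 (y x : Elem M) : rmul τ y (toL2 τ x) = toL2 τ (x * y) :=
  LinearMap.extendOfNorm_eq (denseRange_toL2 τ)
    ⟨‖lmul τ (star y)‖, fun x => norm_toL2_mul_le τ x y⟩ x

variable {τ}

theorem ext_toL2 {S T : L2 τ →L[ℂ] L2 τ} (h : ∀ x, S (toL2 τ x) = T (toL2 τ x)) : S = T :=
  DFunLike.coe_injective
    ((denseRange_toL2 τ).equalizer S.continuous T.continuous (funext h))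

variable (τ)

theorem rmul_mul (x y : Elem M) : rmul τ (x * y) = rmul τ y * rmul τ x :=
  ext_toL2 fun z => by simp only [mul_apply_eq_comp, rmul_toL2, mul_assoc]

theorem rmul_one : rmul τ 1 = 1 :=
  ext_toL2 fun z => by simp only [rmul_toL2, mul_one, one_apply_eq_self]

theorem lmul_rmul (x y : Elem M) : Commute (lmul τ x) (rmul τ y) :=
  ext_toL2 fun z => by simp only [mul_apply_eq_comp, rmul_toL2, lmul_toL2, mul_assoc]

theorem star_rmul (y : Elem M) : star (rmul τ y) = rmul τ (star y) := by
  refine ext_toL2 fun x => ?_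
  refine (denseRange_toL2 τ).eq_of_inner_left ℂ ?_
  intro z
  rw [ContinuousLinearMap.star_eq_adjoint, ContinuousLinearMap.adjoint_inner_left, rmul_toL2,
    rmul_toL2, inner_toL2, inner_toL2, star_mul, star_star, ← mul_assoc, τ.tracial, mul_assoc]

variable (B : VonNeumannAlgebra K)

theorem toL2_mem_L2Sub {b : Elem M} (hb : (b : K →L[ℂ] K) ∈ B) : toL2 τ b ∈ L2Sub τ B :=
  Submodule.le_topologicalClosure _ (Submodule.subset_span ⟨b, hb, rfl⟩)

variable {B} in
/-- Closed subspaces containing `B ξ` contain `L²(B)`. -/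
theorem L2Sub_le {V : Submodule ℂ (L2 τ)} (hV : IsClosed (V : Set (L2 τ)))
    (h : ∀ b : Elem M, (b : K →L[ℂ] K) ∈ B → toL2 τ b ∈ V) : L2Sub τ B ≤ V :=
  Submodule.topologicalClosure_minimal _
    (Submodule.span_le.mpr (by rintro _ ⟨b, hb, rfl⟩; exact h b hb)) hV

variable {B} in
theorem map_mem_L2Sub (T : L2 τ →L[ℂ] L2 τ)
    (h : ∀ b : Elem M, (b : K →L[ℂ] K) ∈ B → T (toL2 τ b) ∈ L2Sub τ B) :
    ∀ x ∈ L2Sub τ B, T x ∈ L2Sub τ B :=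
  L2Sub_le τ (V := (L2Sub τ B).comap T.toLinearMap)
    ((Submodule.isClosed_topologicalClosure _).preimage T.continuous) h

variable {B} in
theorem lmul_mem_L2Sub {b : Elem M} (hb : (b : K →L[ℂ] K) ∈ B) :
    ∀ x ∈ L2Sub τ B, lmul τ b x ∈ L2Sub τ B :=
  map_mem_L2Sub τ _ fun c hc => by
    rw [lmul_toL2]; exact toL2_mem_L2Sub τ B (mul_mem hb hc)

variable {B} in
theorem rmul_mem_L2Sub {b : Elem M} (hb : (b : K →L[ℂ] K) ∈ B) :
    ∀ x ∈ L2Sub τ B, rmul τ b x ∈ L2Sub τ B :=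
  map_mem_L2Sub τ _ fun c hc => by
    rw [rmul_toL2]; exact toL2_mem_L2Sub τ B (mul_mem hc hb)

variable {B} in
theorem jones_lmul {b : Elem M} (hb : (b : K →L[ℂ] K) ∈ B) :
    Commute (jones τ B) (lmul τ b) :=
  commute_starProjection (lmul_mem_L2Sub τ hb) (by
    rw [← map_star]; exact lmul_mem_L2Sub τ (b := star b) (star_mem (S := VonNeumannAlgebra K) hb))

variable {B} in
theorem jones_rmul {b : Elem M} (hb : (b : K →L[ℂ] K) ∈ B) :
    Commute (jones τ B) (rmul τ b) :=
  commute_starProjection (rmul_mem_L2Sub τ hb) (by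
    rw [star_rmul]; exact rmul_mem_L2Sub τ (b := star b) (star_mem (S := VonNeumannAlgebra K) hb))

theorem star_jones : star (jones τ B) = jones τ B := (isSelfAdjoint_starProjection _).star_eq

theorem jones_mul_jones : jones τ B * jones τ B = jones τ B :=
  Submodule.isIdempotentElem_starProjection _

variable {τ B} in
theorem jones_eq_self_iff {x : L2 τ} : jones τ B x = x ↔ x ∈ L2Sub τ B :=
  Submodule.starProjection_eq_self_iff

theorem jones_apply_mem (x : L2 τ) : jones τ B x ∈ L2Sub τ B :=
  Submodule.starProjection_apply_mem _ x

variable {τ B} in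
/-- An operator belongs to `⟨M, e_B⟩` if and only if it commutes with the commutant of `M` and `e_B`. -/
theorem mem_basic_iff {x : L2 τ →L[ℂ] L2 τ} :
    x ∈ basic τ B ↔ ∀ m : L2 τ →L[ℂ] L2 τ, (∀ a, Commute m (lmul τ a)) → Commute m (jones τ B) →
      Commute m x := by
  have h1 : x ∈ basic τ B ↔ x ∈ StarSubalgebra.centralizer ℂ
      (StarSubalgebra.centralizer ℂ (Set.range (lmul τ) ∪ {jones τ B}) : Set (L2 τ →L[ℂ] L2 τ)) :=
    Iff.rfl
  have hgen : ∀ m, m ∈ StarSubalgebra.centralizer ℂ (Set.range (lmul τ) ∪ {jones τ B}) ↔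
      (∀ a, Commute m (lmul τ a)) ∧ Commute m (jones τ B) := by
    intro m
    rw [StarSubalgebra.mem_centralizer_iff]
    constructor
    · intro h
      exact ⟨fun a => (h _ (Or.inl ⟨a, rfl⟩)).1.symm, (h _ (Or.inr rfl)).1.symm⟩
    · rintro ⟨ha, hj⟩ _ (⟨a, rfl⟩ | rfl)
      · exact ⟨(ha a).eq.symm, by rw [← map_star]; exact (ha _).eq.symm⟩
      · rw [star_jones]; exact ⟨hj.eq.symm, hj.eq.symm⟩
  rw [h1, StarSubalgebra.mem_centralizer_iff]
  constructor
  · intro h m ha hj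
    exact (h m ((hgen m).mpr ⟨ha, hj⟩)).1
  · intro h m hm
    have hm' := star_mem hm
    exact ⟨h m ((hgen m).mp hm).1 ((hgen m).mp hm).2,
      h _ ((hgen _).mp hm').1 ((hgen _).mp hm').2⟩

variable {τ B}

/-- Right multiplication by `b ∈ B` commutes with both generators, `M` and `e_B`. -/
theorem basic_commute_rmul {x : L2 τ →L[ℂ] L2 τ} (hx : x ∈ basic τ B) {b : Elem M}
    (hb : (b : K →L[ℂ] K) ∈ B) : Commute x (rmul τ b) :=
  (mem_basic_iff.mp hx _ (fun a => (lmul_rmul τ a b).symm) (jones_rmul τ hb).symm).symm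

theorem relComm_commute_lmul {x : L2 τ →L[ℂ] L2 τ} (hx : x ∈ relComm τ B) {b : Elem M}
    (hb : (b : K →L[ℂ] K) ∈ B) : Commute x (lmul τ b) :=
  (hx.1 _ ⟨b, hb, rfl⟩).symm

theorem star_mem_relComm {x : L2 τ →L[ℂ] L2 τ} (hx : x ∈ relComm τ B) : star x ∈ relComm τ B := by
  refine ⟨?_, star_mem (S := VonNeumannAlgebra (L2 τ)) hx.2⟩
  rintro _ ⟨b, hb, rfl⟩
  have := congrArg star (hx.1 _ ⟨star b, star_mem (S := VonNeumannAlgebra K) hb, rfl⟩)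
  simpa [map_star] using this.symm

/-! ### Normality of the trace and closed balls of `M` in `L²(M, τ)`. -/

open Filter Topology in
/-- Normality of the trace: weak convergence of a bounded family implies convergence of traces. -/
theorem tendsto_trace_mul {ι : Type*} {F : Filter ι} {g : ι → Elem M} {T : Elem M} {r : ℝ}
    (hg : ∀ i, ‖g i‖ ≤ r)
    (h : ∀ v w, Tendsto (fun i => ⟪(g i : K →L[ℂ] K) v, w⟫_ℂ) F
      (𝓝 ⟪(T : K →L[ℂ] K) v, w⟫_ℂ)) (a : Elem M) :
    Tendsto (fun i => τ.toLinearMap (a * g i)) F (𝓝 (τ.toLinearMap (a * T))) := by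
  obtain ⟨ζ, η, hζ, hη, hsum⟩ := τ.normal
  -- Moving `a` onto `ζ i` leaves matrix coefficients of `x` alone, so weak convergence applies
  -- termwise and dominated convergence to the sum.
  have hre : ∀ x : Elem M, τ.toLinearMap (a * x) =
      ∑' i, ⟪star (a : K →L[ℂ] K) (ζ i), (x : K →L[ℂ] K) (η i)⟫_ℂ := by
    intro x
    rw [← (hsum (a * x)).tsum_eq]
    refine tsum_congr fun i => ?_
    rw [ContinuousLinearMap.star_eq_adjoint, ContinuousLinearMap.adjoint_inner_left]
    rfl
  simp only [hre]
  have hs : Summable fun i => ‖ζ i‖ * ‖η i‖ := by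
    refine Summable.of_nonneg_of_le (fun i => by positivity) (fun i => ?_) (hζ.add hη)
    nlinarith [sq_nonneg (‖ζ i‖ - ‖η i‖), sq_nonneg (‖ζ i‖), sq_nonneg (‖η i‖)]
  refine tendsto_tsum_of_dominated_convergence
    (bound := fun i => ‖star (a : K →L[ℂ] K)‖ * r * (‖ζ i‖ * ‖η i‖)) (hs.mul_left _) (fun i => ?_)
    (Eventually.of_forall fun j i => ?_)
  · have := (Complex.continuous_conj.tendsto _).comp (h (η i) (star (a : K →L[ℂ] K) (ζ i)))
    simpa only [Function.comp_def, inner_conj_symm] using this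
  · calc _ ≤ ‖star (a : K →L[ℂ] K) (ζ i)‖ * ‖(g j : K →L[ℂ] K) (η i)‖ := norm_inner_le_norm _ _
      _ ≤ (‖star (a : K →L[ℂ] K)‖ * ‖ζ i‖) * (r * ‖η i‖) := by
        gcongr
        · exact ContinuousLinearMap.le_opNorm _ _
        · exact ContinuousLinearMap.le_of_opNorm_le _ (hg j) _
      _ = _ := by ring

open Filter Topology in
/-- The image in `L²(M, τ)` of a ball of `M` is closed. -/
theorem isClosed_toL2_ball (τ : FaithfulNormalTrace M) {r : ℝ} (hr : 0 ≤ r) :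
    IsClosed (toL2 τ '' {z : Elem M | ‖z‖ ≤ r}) := by
  rw [isClosed_iff_ultrafilter]
  intro ζ F hF hmem
  -- Preimages in the ball, with the junk value `0` off the image, which `F` does not see.
  have hch : ∀ η : L2 τ, ∃ z : Elem M, ‖z‖ ≤ r ∧
      (η ∈ toL2 τ '' {z : Elem M | ‖z‖ ≤ r} → toL2 τ z = η) := by
    intro η
    by_cases hη : η ∈ toL2 τ '' {z : Elem M | ‖z‖ ≤ r}
    · obtain ⟨z, hz, h⟩ := hη
      exact ⟨z, hz, fun _ => h⟩
    · exact ⟨0, by simpa using hr, fun h => absurd h hη⟩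
  choose g hgr hg using hch
  obtain ⟨T, hTr, hT⟩ := exists_weak_limit F (g := fun η => (g η : K →L[ℂ] K)) (r := r) hgr
  -- A weak limit of elements of `M` still commutes with `M'`, and `M'' = M`.
  have hTM : T ∈ M := by
    rw [← VonNeumannAlgebra.commutant_commutant M, VonNeumannAlgebra.mem_commutant_iff]
    intro m hm
    rw [VonNeumannAlgebra.mem_commutant_iff] at hm
    ext v
    refine ext_inner_right ℂ fun w => ?_
    have h1 := hT v (star m w)
    have h2 := hT (m v) w
    simp only [mul_apply_eq_comp]
    have : ∀ η, ⟪(g η : K →L[ℂ] K) v, star m w⟫_ℂ = ⟪(g η : K →L[ℂ] K) (m v), w⟫_ℂ := by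
      intro η
      rw [ContinuousLinearMap.star_eq_adjoint, ContinuousLinearMap.adjoint_inner_right]
      have := DFunLike.congr_fun (hm _ (g η).2) v
      simp only [mul_apply_eq_comp] at this
      rw [this]
    simp only [this] at h1
    rw [← tendsto_nhds_unique h1 h2, ContinuousLinearMap.star_eq_adjoint,
      ContinuousLinearMap.adjoint_inner_right]
  refine ⟨⟨T, hTM⟩, hTr, ?_⟩
  refine (denseRange_toL2 τ).eq_of_inner_right ℂ ?_
  intro a
  have h1 := tendsto_trace_mul (τ := τ) (F := (F : Filter (L2 τ))) (g := g) (T := ⟨T, hTM⟩) hgr hT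
    (star a)
  have h2 : Tendsto (fun η : L2 τ => ⟪toL2 τ a, η⟫_ℂ) F (𝓝 ⟪toL2 τ a, ζ⟫_ℂ) :=
    ((continuous_const.inner continuous_id).tendsto ζ).mono_left hF
  rw [inner_toL2]
  refine tendsto_nhds_unique h1 (h2.congr' ?_)
  filter_upwards [hmem] with η hη
  rw [← inner_toL2, hg η hη]

end L2

/-! ### Averaging over unitaries in `L²(M, τ)`. -/

variable {K : Type*} [NormedAddCommGroup K] [InnerProductSpace ℂ K] [CompleteSpace K]
variable {M B : VonNeumannAlgebra K} {τ : FaithfulNormalTrace M}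

theorem convex_toL2_ball (τ : FaithfulNormalTrace M) (r : ℝ) :
    Convex ℝ (toL2 τ '' {z : Elem M | ‖z‖ ≤ r}) := by
  rintro _ ⟨z, hz, rfl⟩ _ ⟨w, hw, rfl⟩ a b ha hb hab
  refine ⟨(a : ℂ) • z + (b : ℂ) • w, ?_, ?_⟩
  · have hz : ‖z‖ ≤ r := hz
    have hw : ‖w‖ ≤ r := hw
    calc ‖(a : ℂ) • z + (b : ℂ) • w‖ ≤ ‖(a : ℂ) • z‖ + ‖(b : ℂ) • w‖ := norm_add_le _ _
      _ = a * ‖z‖ + b * ‖w‖ := by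
        rw [norm_smul, norm_smul, Complex.norm_of_nonneg ha, Complex.norm_of_nonneg hb]
      _ ≤ a * r + b * r := by gcongr
      _ = r := by rw [← add_mul, hab, one_mul]
  · rw [map_add, map_smul, map_smul, Complex.coe_smul, Complex.coe_smul]

theorem norm_lmul_rmul_apply (τ : FaithfulNormalTrace M) {u : Elem M} (hu : u * star u = 1)
    (z : L2 τ) : ‖(lmul τ (star u) * rmul τ u) z‖ = ‖z‖ := by
  refine (denseRange_toL2 τ).induction_on z
    (isClosed_eq (ContinuousLinearMap.continuous _).norm continuous_norm) fun a => ?_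
  have h : star (star u * (a * u)) * (star u * (a * u)) = star u * (star a * a * u) := by
    simp only [star_mul, star_star]
    calc star u * star a * u * (star u * (a * u))
        = star u * star a * (u * star u) * a * u := by simp only [mul_assoc]
      _ = _ := by rw [hu, mul_one]; simp only [mul_assoc]
  rw [mul_apply_eq_comp, rmul_toL2, lmul_toL2, @norm_eq_sqrt_re_inner ℂ,
    @norm_eq_sqrt_re_inner ℂ, inner_toL2, inner_toL2, h, τ.tracial, mul_assoc, hu, mul_one]

/-- Moving both factors across the inner product turns `ω` into `u ω u* = ω u u* = ω`. -/
theorem inner_lmul_rmul_eq {u : Elem M} (hu : u * star u = 1) {ω : L2 τ}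
    (hω : lmul τ u ω = rmul τ u ω) (z : L2 τ) :
    ⟪ω, (lmul τ (star u) * rmul τ u) z⟫_ℂ = ⟪ω, z⟫_ℂ := by
  rw [mul_apply_eq_comp, map_star, ContinuousLinearMap.star_eq_adjoint,
    ContinuousLinearMap.adjoint_inner_right, hω, ← ContinuousLinearMap.adjoint_inner_left,
    ← ContinuousLinearMap.star_eq_adjoint, star_rmul, ← mul_apply_eq_comp, ← rmul_mul, hu,
    rmul_one, one_apply_eq_self]

theorem lmul_rmul_mul (τ : FaithfulNormalTrace M) (u w : Elem M) :
    lmul τ (star u) * rmul τ u * (lmul τ (star w) * rmul τ w) =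
      lmul τ (star (w * u)) * rmul τ (w * u) := by
  refine ext_toL2 fun z => ?_
  simp only [mul_apply_eq_comp, rmul_toL2, lmul_toL2, star_mul, mul_assoc]

/-- Averaging `x ∈ M` over the unitaries of a `*`-subalgebra `N` of `M`: on vectors commuting with
`N`, the vector `x ξ` acts as `y ξ` for some `y ∈ N' ∩ M`. -/
theorem exists_average (τ : FaithfulNormalTrace M) {N : StarSubalgebra ℂ (K →L[ℂ] K)}
    (hcl : IsClosed (N : Set (K →L[ℂ] K))) (hNM : ∀ b ∈ N, b ∈ M) (x : Elem M) :
    ∃ y : Elem M, (∀ b ∈ N, Commute b (y : K →L[ℂ] K)) ∧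
      ∀ ω : L2 τ, (∀ b : Elem M, (b : K →L[ℂ] K) ∈ N → lmul τ b ω = rmul τ b ω) →
        ⟪ω, toL2 τ x⟫_ℂ = ⟪ω, toL2 τ y⟫_ℂ := by
  let U : Set (Elem M) := {u | (u : K →L[ℂ] K) ∈ N ∧ u ∈ unitary (Elem M)}
  let G : Set (L2 τ →L[ℂ] L2 τ) := (fun u => lmul τ (star u) * rmul τ u) '' U
  obtain ⟨_, ⟨y, -, rfl⟩, hfix, hinner⟩ := exists_fixed_mem_of_contractions (G := G)
    ⟨1, ⟨one_mem N, one_mem _⟩, by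
      change lmul τ (star 1) * rmul τ 1 = 1
      rw [star_one, map_one, rmul_one, one_mul]⟩
    (by
      rintro _ ⟨u, hu, rfl⟩ _ ⟨w, hw, rfl⟩
      exact ⟨w * u, ⟨mul_mem hw.1 hu.1, mul_mem hw.2 hu.2⟩, (lmul_rmul_mul τ u w).symm⟩)
    (by
      rintro _ ⟨u, hu, rfl⟩ z
      exact (norm_lmul_rmul_apply τ hu.2.2 z).le)
    -- Conjugation by unitaries keeps the orbit of `x ξ` in the image of the ball of radius `‖x‖`.
    -- That image is closed and convex, so the fixed vector is again of the form `y ξ` with `y ∈ M`.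
    (toL2 τ x) (isClosed_toL2_ball τ (norm_nonneg x)) (convex_toL2_ball τ ‖x‖)
    (by
      rintro _ ⟨u, hu, rfl⟩
      refine ⟨star u * (x * u), ?_, ?_⟩
      · exact ((CStarRing.norm_mem_unitary_mul _ (Unitary.star_mem hu.2)).trans
          (CStarRing.norm_mul_mem_unitary _ hu.2)).le
      · rw [← lmul_toL2, ← rmul_toL2, mul_apply_eq_comp])
  refine ⟨y, ?_, fun ω hω => (hinner ω ?_).symm⟩
  · let V : Submodule ℂ (K →L[ℂ] K) :=
      (Subalgebra.centralizer ℂ {(y : K →L[ℂ] K)}).toSubmodule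
    have hV : ∀ z, z ∈ V ↔ Commute z (y : K →L[ℂ] K) := by
      intro z
      simp only [V, Subalgebra.mem_toSubmodule, Subalgebra.mem_centralizer_iff,
        Set.mem_singleton_iff, forall_eq]
      exact eq_comm
    intro b hb
    refine (hV b).mp (mem_of_unitary_mem N hcl V (fun u hu h1 h2 => (hV u).mpr ?_) b hb)
    have h3 := hfix _ ⟨⟨u, hNM u hu⟩, ⟨hu, Subtype.ext h1, Subtype.ext h2⟩, rfl⟩
    rw [mul_apply_eq_comp, rmul_toL2, lmul_toL2] at h3
    have h4 : star u * ((y : K →L[ℂ] K) * u) = y := congrArg Subtype.val (toL2_injective τ h3)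
    change u * (y : K →L[ℂ] K) = y * u
    calc u * (y : K →L[ℂ] K) = u * (star u * (y * u)) := by rw [h4]
      _ = u * star u * (y * u) := by simp only [mul_assoc]
      _ = y * u := by rw [h2, one_mul]
  · rintro _ ⟨u, hu, rfl⟩
    exact inner_lmul_rmul_eq hu.2.2 (hω u hu.1) _

/-! ### Relative commutants, corners of `B`, and vectors of `L²(B)`. -/

theorem isClosed_starSubalgebra_centralizer (s : Set (K →L[ℂ] K)) :
    IsClosed (StarSubalgebra.centralizer ℂ s : Set (K →L[ℂ] K)) := by
  rw [StarSubalgebra.coe_centralizer]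
  exact Set.isClosed_centralizer _

/-- Presents the relative commutant `A ∩ s'` as a single centralizer, hence as a closed `*`-algebra
spanned by its unitaries. -/
theorem mem_centralizer_commutant_union {A : VonNeumannAlgebra K} {s : Set (K →L[ℂ] K)}
    (hs : ∀ b ∈ s, star b ∈ s) {x : K →L[ℂ] K} :
    x ∈ StarSubalgebra.centralizer ℂ ((A.commutant : Set (K →L[ℂ] K)) ∪ s) ↔
      x ∈ A ∧ ∀ b ∈ s, Commute b x := by
  rw [StarSubalgebra.mem_centralizer_iff]
  have hA : x ∈ A ↔ ∀ m ∈ A.commutant, m * x = x * m := by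
    conv_lhs => rw [← VonNeumannAlgebra.commutant_commutant A, VonNeumannAlgebra.mem_commutant_iff]
  rw [hA]
  constructor
  · exact fun h => ⟨fun m hm => (h m (Or.inl hm)).1, fun b hb => (h b (Or.inr hb)).1⟩
  · rintro ⟨h1, h2⟩ m (hm | hm)
    · exact ⟨h1 m hm, h1 _ (star_mem (S := VonNeumannAlgebra K) hm)⟩
    · exact ⟨h2 m hm, h2 _ (hs m hm)⟩

/-- If `B' ∩ M ⊆ B` and `p ∈ B` is a projection, then `y p ∈ B` for every `y ∈ M` commuting with
the elements of `B` that commute with `p`. -/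
theorem mul_mem_of_commute_corner (hBM : B ≤ M)
    (hB : Set.centralizer (B : Set (K →L[ℂ] K)) ∩ (M : Set (K →L[ℂ] K)) ⊆ (B : Set (K →L[ℂ] K)))
    {p : K →L[ℂ] K} (hpB : p ∈ B) (hp : IsStarProjection p) {y : K →L[ℂ] K} (hyM : y ∈ M)
    (hy : ∀ b ∈ B, Commute b p → Commute b y) : y * p ∈ B := by
  let s : Set (K →L[ℂ] K) := {b | b ∈ B ∧ Commute b p}
  have hs : ∀ b ∈ s, star b ∈ s := by
    rintro b ⟨hb, hbp⟩
    refine ⟨star_mem hb, ?_⟩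
    have := hbp.star_star
    rwa [hp.isSelfAdjoint.star_eq] at this
  let V : Submodule ℂ (K →L[ℂ] K) :=
    B.toStarSubalgebra.toSubalgebra.toSubmodule.comap (LinearMap.mulRight ℂ p)
  refine mem_of_unitary_mem
    (StarSubalgebra.centralizer ℂ ((M.commutant : Set (K →L[ℂ] K)) ∪ s))
    (isClosed_starSubalgebra_centralizer _) V (fun u hu h1 _ => ?_) y
    ((mem_centralizer_commutant_union hs).mpr ⟨hyM, fun b hb => hy b hb.1 hb.2⟩)
  obtain ⟨huM, hus⟩ := (mem_centralizer_commutant_union hs).mp hu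
  have hpp : p * p = p := hp.isIdempotentElem
  obtain ⟨T, hTB, hTp, hT⟩ := exists_centralizer_extension B.toStarSubalgebra hpB hp h1
    (hus p ⟨hpB, Commute.refl p⟩).symm (fun b hb =>
      (hus _ ⟨mul_mem (mul_mem hpB hb) hpB, by
        change p * b * p * p = p * (p * b * p)
        rw [mul_assoc (p * b), hpp, ← mul_assoc, ← mul_assoc, hpp]⟩).symm)
  -- Elements of `M'` commute with `B` and with `u ∈ M`, hence with the canonical extension `T`; so
  -- `T ∈ M'' = M`.
  have hTM : T ∈ M := by
    rw [← VonNeumannAlgebra.commutant_commutant M, VonNeumannAlgebra.mem_commutant_iff]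
    intro m hm
    rw [VonNeumannAlgebra.mem_commutant_iff] at hm
    exact (hT m (fun b hb => hm b (hBM hb)) (hm u huM).symm).eq.symm
  change u * p ∈ B
  rw [← hTp]
  exact mul_mem (hB ⟨hTB, hTM⟩) hpB

/-- If `B' ∩ M ⊆ B` and `p ∈ B` is a projection, then a vector `ω = p ω` commuting with the elements
of `B` that commute with `p` belongs to `L²(B)`. -/
theorem mem_L2Sub_of_commute_corner (hBM : B ≤ M)
    (hB : Set.centralizer (B : Set (K →L[ℂ] K)) ∩ (M : Set (K →L[ℂ] K)) ⊆ (B : Set (K →L[ℂ] K)))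
    {p : Elem M} (hpB : (p : K →L[ℂ] K) ∈ B) (hp : IsStarProjection p) {ω : L2 τ}
    (hpω : lmul τ p ω = ω)
    (hω : ∀ b : Elem M, (b : K →L[ℂ] K) ∈ B → Commute b p → lmul τ b ω = rmul τ b ω) :
    ω ∈ L2Sub τ B := by
  have hpK : IsStarProjection (p : K →L[ℂ] K) :=
    ⟨congrArg Subtype.val hp.isIdempotentElem, congrArg Subtype.val hp.isSelfAdjoint⟩
  let N := StarSubalgebra.centralizer ℂ ((B.commutant : Set (K →L[ℂ] K)) ∪ {(p : K →L[ℂ] K)})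
  have hN : ∀ b, b ∈ N ↔ b ∈ B ∧ Commute b (p : K →L[ℂ] K) := by
    intro b
    refine (mem_centralizer_commutant_union ?_).trans ?_
    · rintro _ rfl; exact hpK.isSelfAdjoint
    · simp [commute_iff_eq, eq_comm]
  -- The component orthogonal to `L²(B)` inherits both properties of `ω`, because `e_B` commutes
  -- with left and right multiplication by `B`. It is shown to vanish.
  let ω' := ω - jones τ B ω
  have happ : ∀ {S T : L2 τ →L[ℂ] L2 τ}, Commute S T → ∀ z, S (T z) = T (S z) :=
    fun h z => DFunLike.congr_fun h.eq z
  have hω' : ∀ b : Elem M, (b : K →L[ℂ] K) ∈ N → lmul τ b ω' = rmul τ b ω' := by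
    intro b hb
    obtain ⟨hbB, hbp⟩ := (hN b).mp hb
    have := hω b hbB (Subtype.ext hbp)
    simp only [ω', map_sub]
    rw [← happ (jones_lmul τ hbB), ← happ (jones_rmul τ hbB), this]
  have hpω' : lmul τ p ω' = ω' := by
    simp only [ω', map_sub]
    rw [← happ (jones_lmul τ hpB), hpω]
  have h0 : ω' = 0 := by
    refine (denseRange_toL2 τ).eq_zero_of_inner_left ℂ fun x => ?_
    obtain ⟨y, hyN, hy⟩ := exists_average τ (isClosed_starSubalgebra_centralizer _)
      (fun b hb => hBM ((hN b).mp hb).1) x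
    rw [hy ω' hω', ← hpω', ← ContinuousLinearMap.adjoint_inner_right,
      ← ContinuousLinearMap.star_eq_adjoint, ← map_star, hp.isSelfAdjoint.star_eq, lmul_toL2]
    have hyp : (p : K →L[ℂ] K) * y = y * p := hyN p ((hN p).mpr ⟨hpB, Commute.refl _⟩)
    refine Submodule.inner_left_of_mem_orthogonal (K := L2Sub τ B) (toL2_mem_L2Sub τ B ?_) ?_
    · change (p : K →L[ℂ] K) * y ∈ B
      rw [hyp]
      exact mul_mem_of_commute_corner hBM hB hpB hpK y.2
        fun b hb hbp => hyN b ((hN b).mpr ⟨hb, hbp⟩)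
    · exact Submodule.sub_starProjection_mem_orthogonal ω
  exact jones_eq_self_iff.mp (sub_eq_zero.mp h0).symm

/-! ### The projection `v* e_B v` of an intertwiner `v`. -/

section Intertwiner

variable {v : Elem M}

theorem IsIntertwiner.range_mem (hv : IsIntertwiner B v) :
    ((v * star v : Elem M) : K →L[ℂ] K) ∈ B := by
  have := hv.conj_mem 1 (one_mem B)
  rwa [mul_one] at this

theorem IsIntertwiner.star_mul_mul_star (hv : IsIntertwiner B v) : star v * v * star v = star v := by
  have := congrArg star hv.partialIsometry
  simpa [mul_assoc] using this

theorem IsIntertwiner.isStarProjection_source (hv : IsIntertwiner B v) :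
    IsStarProjection (star v * v) :=
  ⟨by rw [IsIdempotentElem, ← mul_assoc, hv.star_mul_mul_star], IsSelfAdjoint.star_mul_self v⟩

theorem IsIntertwiner.isStarProjection_conjJones (τ : FaithfulNormalTrace M)
    (hv : IsIntertwiner B v) : IsStarProjection (conjJones τ B v) := by
  constructor
  · have hq := (jones_lmul τ hv.range_mem).eq
    change lmul τ (star v) * jones τ B * lmul τ v * (lmul τ (star v) * jones τ B * lmul τ v) =
      lmul τ (star v) * jones τ B * lmul τ v
    calc _ = lmul τ (star v) * (jones τ B * lmul τ (v * star v)) * jones τ B * lmul τ v := by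
          rw [map_mul]; simp only [mul_assoc]
      _ = lmul τ (star v * v * star v) * (jones τ B * jones τ B) * lmul τ v := by
          rw [hq]; simp only [map_mul, mul_assoc]
      _ = _ := by rw [jones_mul_jones, hv.star_mul_mul_star]
  · have h : IsSelfAdjoint (jones τ B) := star_jones τ B
    rw [conjJones, map_star]
    exact h.conjugate' (lmul τ v)

theorem IsIntertwiner.source_mul_conjJones (τ : FaithfulNormalTrace M) (hv : IsIntertwiner B v) :
    lmul τ (star v * v) * conjJones τ B v = conjJones τ B v := by
  rw [conjJones, ← mul_assoc, ← mul_assoc, ← map_mul, hv.star_mul_mul_star]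

theorem IsIntertwiner.conjJones_mul_source (τ : FaithfulNormalTrace M) (hv : IsIntertwiner B v) :
    conjJones τ B v * lmul τ (star v * v) = conjJones τ B v := by
  rw [conjJones, mul_assoc, ← map_mul, ← mul_assoc v, hv.partialIsometry]

/-- `v* e_B v` commutes with the corner of `B` at `v* v`. -/
theorem IsIntertwiner.commute_conjJones (τ : FaithfulNormalTrace M) (hv : IsIntertwiner B v)
    {b : Elem M} (hb : (b : K →L[ℂ] K) ∈ B) :
    Commute (conjJones τ B v) (lmul τ (star v * v) * lmul τ b * lmul τ (star v * v)) := by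
  rw [map_mul, conjJones]
  refine commute_conj_of_commute ?_ ?_ ?_
  · simpa only [map_mul] using congrArg (lmul τ) hv.partialIsometry
  · simpa only [map_mul] using congrArg (lmul τ) hv.star_mul_mul_star
  · have h := jones_lmul τ (b := v * b * star v) (hv.conj_mem b hb)
    rwa [map_mul (lmul τ) (v * b), map_mul (lmul τ) v] at h

/-- The corner extension is applied to the image of `B` on `L²(M, τ)`. An operator commuting with
`M` and `e_B` commutes with that image and with `v* e_B v`, hence with the extension, which
therefore lies in `⟨M, e_B⟩`. -/
theorem IsIntertwiner.conjJones_mem_cutdown (τ : FaithfulNormalTrace M)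
    (hv : IsIntertwiner B v) : conjJones τ B v ∈ cutdown τ B (star v * v) := by
  let A : StarSubalgebra ℂ (L2 τ →L[ℂ] L2 τ) :=
    (B.toStarSubalgebra.comap M.toStarSubalgebra.subtype).map (lmul τ)
  have hA : ∀ z ∈ A, ∃ b : Elem M, (b : K →L[ℂ] K) ∈ B ∧ lmul τ b = z := fun z hz => hz
  have hA' : ∀ b : Elem M, (b : K →L[ℂ] K) ∈ B → lmul τ b ∈ A := fun b hb => ⟨b, hb, rfl⟩
  obtain ⟨x, hxA, hfx, hx⟩ := exists_centralizer_mul_eq A (hA' _ hv.source_mem)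
    (hv.isStarProjection_source.map (lmul τ)) (hv.isStarProjection_conjJones τ)
    (hv.source_mul_conjJones τ) (hv.conjJones_mul_source τ) (fun z hz => by
      obtain ⟨b, hb, rfl⟩ := hA z hz
      exact hv.commute_conjJones τ hb)
  refine ⟨x, ⟨?_, mem_basic_iff.mpr fun m hm hmj => hx m (fun z hz => ?_) ?_⟩, hfx⟩
  · rintro _ ⟨b, hb, rfl⟩
    exact hxA _ (hA' b hb)
  · obtain ⟨b, -, rfl⟩ := hA z hz
    exact (hm b).eq.symm
  · exact ((hm _).mul_right hmj).mul_right (hm _)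

/-- Elements of `B' ∩ ⟨M, e_B⟩` map the vector `v* ξ` into `v* L²(B)`. -/
theorem IsIntertwiner.conjJones_apply (hBM : B ≤ M)
    (hB : Set.centralizer (B : Set (K →L[ℂ] K)) ∩ (M : Set (K →L[ℂ] K)) ⊆ (B : Set (K →L[ℂ] K)))
    (hv : IsIntertwiner B v) {x : L2 τ →L[ℂ] L2 τ} (hx : x ∈ relComm τ B) :
    conjJones τ B v (x (toL2 τ (star v))) = x (toL2 τ (star v)) := by
  have happ : ∀ {S T : L2 τ →L[ℂ] L2 τ}, Commute S T → ∀ z, S (T z) = T (S z) :=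
    fun h z => DFunLike.congr_fun h.eq z
  set η := x (toL2 τ (star v)) with hη
  have hpη : lmul τ (star v * v) η = η := by
    rw [hη, ← happ (relComm_commute_lmul hx hv.source_mem), lmul_toL2, hv.star_mul_mul_star]
  have hω : rmul τ v η ∈ L2Sub τ B := by
    refine mem_L2Sub_of_commute_corner hBM hB (p := star v * v) hv.source_mem
      hv.isStarProjection_source ?_ ?_
    · rw [happ (lmul_rmul τ _ _), hpη]
    · intro b hb hbp
      have hc : ((v * b * star v : Elem M) : K →L[ℂ] K) ∈ B := hv.conj_mem b hb
      -- As `b` commutes with `v* v`, left multiplication of `v*` by `b` is right multiplication by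
      -- `v b v* ∈ B`, and `x` commutes with the latter.
      have h1 : b * star v = star v * (v * b * star v) := by
        calc b * star v = b * (star v * v) * star v := by
              rw [mul_assoc, hv.star_mul_mul_star]
          _ = _ := by rw [hbp.eq]; simp only [mul_assoc]
      have h2 : v * b * star v * v = v * b := by
        calc v * b * star v * v = v * (b * (star v * v)) := by simp only [mul_assoc]
          _ = v * star v * v * b := by rw [hbp.eq]; simp only [mul_assoc]
          _ = _ := by rw [hv.partialIsometry]
      rw [happ (lmul_rmul τ _ _), hη, ← happ (relComm_commute_lmul hx hb), lmul_toL2, h1,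
        ← rmul_toL2, happ (basic_commute_rmul hx.2 hc), ← mul_apply_eq_comp, ← rmul_mul, h2,
        rmul_mul, mul_apply_eq_comp]
  have hζ : lmul τ v η ∈ L2Sub τ B := by
    -- This vector is `v ω v*` with `ω = η v`; it equals `v η` because `η v v* = x (v* v v* ξ) = η`.
    have h1 : lmul τ v (rmul τ (star v) (rmul τ v η)) ∈ L2Sub τ B := by
      refine map_mem_L2Sub τ (lmul τ v * rmul τ (star v)) (fun b hb => ?_) _ hω
      rw [mul_apply_eq_comp, rmul_toL2, lmul_toL2, ← mul_assoc]
      exact toL2_mem_L2Sub τ B (hv.conj_mem b hb)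
    rwa [← mul_apply_eq_comp (rmul τ (star v)), ← rmul_mul, hη,
      ← happ (basic_commute_rmul hx.2 hv.range_mem), rmul_toL2, ← mul_assoc,
      hv.star_mul_mul_star] at h1
  change lmul τ (star v) (jones τ B (lmul τ v η)) = η
  rw [jones_eq_self_iff.mpr hζ, ← mul_apply_eq_comp, ← map_mul, hpη]

/-- Right multiplication by `B` spreads the identity at `v* ξ` to all `v* b ξ`, and continuity to
`v* L²(B)`, which contains the range of `v* e_B v`. -/
theorem IsIntertwiner.conjJones_mul_mul (hBM : B ≤ M)
    (hB : Set.centralizer (B : Set (K →L[ℂ] K)) ∩ (M : Set (K →L[ℂ] K)) ⊆ (B : Set (K →L[ℂ] K)))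
    (hv : IsIntertwiner B v) {x : L2 τ →L[ℂ] L2 τ} (hx : x ∈ relComm τ B) :
    conjJones τ B v * x * conjJones τ B v = x * conjJones τ B v := by
  have happ : ∀ {S T : L2 τ →L[ℂ] L2 τ}, Commute S T → ∀ z, S (T z) = T (S z) :=
    fun h z => DFunLike.congr_fun h.eq z
  let S := conjJones τ B v * x * lmul τ (star v)
  let T := x * lmul τ (star v)
  have hST : L2Sub τ B ≤ LinearMap.eqLocus S.toLinearMap T.toLinearMap := by
    refine L2Sub_le τ (isClosed_eq S.continuous T.continuous) fun b hb => ?_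
    have hf : Commute (conjJones τ B v) (rmul τ b) :=
      ((lmul_rmul τ _ b).mul_left (jones_rmul τ hb)).mul_left (lmul_rmul τ _ b)
    change conjJones τ B v (x (lmul τ (star v) (toL2 τ b))) = x (lmul τ (star v) (toL2 τ b))
    rw [lmul_toL2, ← rmul_toL2, happ (basic_commute_rmul hx.2 hb), happ hf,
      hv.conjJones_apply hBM hB hx]
  ext z
  exact hST (jones_apply_mem τ B (lmul τ v z))

/-- `v* e_B v` commutes with `B' ∩ ⟨M, e_B⟩`. -/
theorem IsIntertwiner.conjJones_commute_relComm (hBM : B ≤ M)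
    (hB : Set.centralizer (B : Set (K →L[ℂ] K)) ∩ (M : Set (K →L[ℂ] K)) ⊆ (B : Set (K →L[ℂ] K)))
    (hv : IsIntertwiner B v) {x : L2 τ →L[ℂ] L2 τ} (hx : x ∈ relComm τ B) :
    Commute (conjJones τ B v) x := by
  have h1 := hv.conjJones_mul_mul hBM hB hx
  -- The adjoint of the invariance relation for `x*` is `f x f = f x`, with `f = v* e_B v`.
  have h2 := congrArg star (hv.conjJones_mul_mul hBM hB (star_mem_relComm hx))
  simp only [star_mul, star_star, (hv.isStarProjection_conjJones τ).isSelfAdjoint.star_eq] at h2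
  rw [← mul_assoc] at h2
  exact h2.symm.trans h1

end Intertwiner

end BasicConstruction

end

theorem lemma3p2 {K : Type*} [NormedAddCommGroup K] [InnerProductSpace ℂ K] [CompleteSpace K]
    (M B : VonNeumannAlgebra K) (hBM : B ≤ M)
    (τ : BasicConstruction.FaithfulNormalTrace M)
    (hB : Set.centralizer (B : Set (K →L[ℂ] K)) ∩ (M : Set (K →L[ℂ] K)) ⊆ (B : Set (K →L[ℂ] K)))
    (v : BasicConstruction.Elem M) (hv : BasicConstruction.IsIntertwiner B v) :
    IsStarProjection (BasicConstruction.conjJones τ B v) ∧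
      BasicConstruction.conjJones τ B v ∈ BasicConstruction.cutdown τ B (star v * v) ∧
      ∀ y ∈ BasicConstruction.cutdown τ B (star v * v),
        BasicConstruction.conjJones τ B v * y = y * BasicConstruction.conjJones τ B v := by
  refine ⟨hv.isStarProjection_conjJones τ, hv.conjJones_mem_cutdown τ, ?_⟩
  rintro _ ⟨x, hx, rfl⟩
  have h := (hv.conjJones_commute_relComm hBM hB hx).eq
  -- With `f = v* e_B v` and `p = v* v`, both sides reduce to `x f`, since `f p = f = p f`.
  rw [← mul_assoc, h, mul_assoc, mul_assoc, hv.conjJones_mul_source τ, hv.source_mul_conjJones τ]
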